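/- For $r \ge 0$ let $\phi_2(r) = r^2 \log r$ for $r > 0$ and $\phi_2(0) = 0$. A closed axis-parallel box in $\mathbb{R}^2$ is a set $[a_1,b_1]\times[a_2,b_2]$ with $a_i \le b_i$; $\operatorname{diam}$ and $\operatorname{dist}$ are taken in the Euclidean norm. For $p \in \mathbb{N}_0$ and closed axis-parallel boxes $\sigma,\tau \subset \mathbb{R}^2$, let $I_p^{\mathrm{Cheb}}$ be the tensor product Chebyshev interpolation operator on $\sigma\times\tau\subset\mathbb{R}^4$: it maps a continuous function on $\sigma\times\tau$ to the polynomial of degree at most $p$ in each of the four variables that agrees with it at the tensor product grid obtained by transporting affinely, to each of the four coordinate intervals of $\sigma \times \tau$, the Chebyshev points $\cos\frac{(2j+1)\pi}{2(p+1)}$, $j=0,\dots,p$, of $[-1,1]$ (for a coordinate interval that is a single point, the interpolant is taken constant in that variable). Let $\eta > 0$. Then there are constants $C, b > 0$ depending only on $\eta$ such that for all closed axis-parallel boxes $\sigma, \tau \subset \mathbb{R}^2$ with $$\max\{\operatorname{diam}(\sigma), \operatorname{diam}(\tau)\} \le \eta \operatorname{dist}(\sigma,\tau)$$ and all $p \in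 \mathbb{N}_0$, $$\sup_{(x,y)\in\sigma\times\tau} \bigl|\phi_2(\|x-y\|_2) - \bigl(I_p^{\mathrm{Cheb}}\, \phi_2(\|\cdot-\cdot\|_2)\bigr)(x,y)\bigr| \le C \operatorname{dist}(\sigma,\tau)^2 \bigl(1 + |\log \operatorname{dist}(\sigma,\tau)|\bigr) e^{-bp}.$$ Here, if $\operatorname{dist}(\sigma,\tau) = 0$ (which forces $\sigma=\tau$ to be a single point), the right-hand side is read as $0$. -/

import Mathlib

noncomputable section

/-- The thin plate spline function `φ₂(r) = r² log r` (with value `0` at `r = 0`). -/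
def phi2 (r : ℝ) : ℝ := r ^ 2 * Real.log r

/-- The closed axis-parallel box `[a₀, b₀] × [a₁, b₁]` in the Euclidean plane. -/
def box (a b : Fin 2 → ℝ) : Set (EuclideanSpace ℝ (Fin 2)) :=
  {x | ∀ i, x i ∈ Set.Icc (a i) (b i)}

/-- The distance `inf {‖x - y‖ : x ∈ S, y ∈ T}` of two (nonempty) sets in the Euclidean plane. -/
def setDist (S T : Set (EuclideanSpace ℝ (Fin 2))) : ℝ :=
  sInf {r | ∃ x ∈ S, ∃ y ∈ T, r = dist x y}

/-- The Chebyshev points `cos((2j+1)π/(2(p+1)))`, `j = 0, …, p`, of the interval `[-1, 1]`,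
that is, the zeros of the Chebyshev polynomial `T_{p+1}`. -/
def chebNode (p : ℕ) (j : Fin (p + 1)) : ℝ :=
  Real.cos ((2 * (j : ℝ) + 1) * Real.pi / (2 * ((p : ℝ) + 1)))

/-- The affine map from `[-1, 1]` onto `[a, b]`. -/
def fromRef (a b t : ℝ) : ℝ := (a + b) / 2 + (b - a) / 2 * t

/-- The affine map from `[a, b]` onto `[-1, 1]`, inverse to `fromRef a b`, if `a < b`.
If `a = b`, its value is `0`. -/
def toRef (a b x : ℝ) : ℝ := (2 * x - a - b) / (b - a)

/-- The Lagrange basis polynomial of degree `p` for the Chebyshev points of `[-1, 1]` that is `1`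
at the `j`-th point and `0` at the others. -/
def chebBasis (p : ℕ) (j : Fin (p + 1)) : Polynomial ℝ :=
  Lagrange.basis Finset.univ (chebNode p) j

/-- The tensor product Chebyshev interpolant of degree `p` in each variable of a function `f` on the
box `∏ i, [a i, b i]`: the points are the products of the transported one-dimensional points, and
`f` enters only through its values at these points. In a direction with `a i = b i` (a one-point
interval) the basis polynomials are evaluated at `0`, where they sum to `1`, so the interpolation
in that direction is the identity. -/
def chebInterp {ι : Type*} [Fintype ι] [DecidableEq ι] (p : ℕ) (a b : ι → ℝ)
    (f : (ι → ℝ) → ℝ) (x : ι → ℝ) : ℝ :=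
  ∑ k : ι → Fin (p + 1), f (fun i => fromRef (a i) (b i) (chebNode p (k i))) *
    ∏ i, (chebBasis p (k i)).eval (toRef (a i) (b i) (x i))

/-- The function `(x, y) ↦ φ₂(‖x - y‖₂)` on `ℝ² × ℝ²`, in the four coordinates: those of `x` are
indexed by `Sum.inl`, those of `y` by `Sum.inr`. -/
def tpsKernel (z : Fin 2 ⊕ Fin 2 → ℝ) : ℝ :=
  phi2 ‖(WithLp.toLp 2 fun i => z (Sum.inl i) : EuclideanSpace ℝ (Fin 2)) -
    WithLp.toLp 2 fun i => z (Sum.inr i)‖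

/-- The value at `(x, y)` of the tensor product Chebyshev interpolant of degree `p` of
`(x, y) ↦ φ₂(‖x - y‖₂)` on `box a b × box c d`. -/
def tpsInterp (p : ℕ) (a b c d : Fin 2 → ℝ) (x y : EuclideanSpace ℝ (Fin 2)) : ℝ :=
  chebInterp p (Sum.elim a c) (Sum.elim b d) tpsKernel (Sum.elim (fun i => x i) (fun i => y i))

end

/-!
The kernel is `(s log s) / 2` with `s = ‖x - y‖²`, and `s` is a polynomial of degree two in each of
the four coordinates. No complex analysis is needed: a polynomial of degree `N ≤ p / 2` in `s` is
reproduced by the interpolation operator, so the error is at most `1 + Λ` times the error of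
approximating `s ↦ (s log s) / 2` uniformly by such polynomials, where `Λ` is the Lebesgue constant
of the tensor grid (`abs_sub_chebInterp_le`).

*Approximation.* Let `d` be the distance of the boxes. Admissibility confines `s` to `[d², K d²]`
with `K = (1 + 2η)²`. After scaling by `d²`, the Taylor polynomials of the logarithm at the right end
point `K` converge on `[1, K]` at the geometric rate `1 - 1 / K < 1`, for every `η`
(`exists_polynomial_mul_log_approx`). Scaling back produces the factor `d² (1 + |log d|)`; the
logarithm is needed only when `p < 2`, when a linear function of `s` is not yet reproduced
(`exists_polynomial_half_mul_log_approx`).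

*Stability.* A crude bound for `Λ` suffices, since algebraic growth is absorbed by the exponential
decay (`exists_one_add_pow_mul_pow_half_le_exp`). With `n = p + 1`, the Lagrange basis polynomials
are `T_n(t) / ((t - x_j) T_n'(x_j))`; since `|T_n'| ≤ n²` on `[-1, 1]` and `|T_n'(x_j)| ≥ n`, each of
them is bounded by `n` (`abs_eval_chebBasis_le`), so `Λ ≤ n ^ 8`.
-/

/-! ### Lagrange basis polynomials at the Chebyshev points -/

open Polynomial in
lemma chebNode_injective (p : ℕ) : Function.Injective (chebNode p) := by
  have h := (Multiset.nodup_map_iff_inj_on (Multiset.nodup_range _)).1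
    (Chebyshev.roots_T_real_nodup (p + 1))
  intro i j hij
  refine Fin.ext (h i (Multiset.mem_range.2 i.2) j (Multiset.mem_range.2 j.2) ?_)
  simpa [chebNode] using hij

lemma chebNode_mem_Icc (p : ℕ) (j : Fin (p + 1)) : chebNode p j ∈ Set.Icc (-1 : ℝ) 1 :=
  ⟨Real.neg_one_le_cos _, Real.cos_le_one _⟩

open Polynomial in
lemma chebyshev_T_eq_leadingCoeff_mul_nodal (p : ℕ) :
    Chebyshev.T ℝ ((p + 1 : ℕ) : ℤ) = C (Chebyshev.T ℝ ((p + 1 : ℕ) : ℤ)).leadingCoeff *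
      Lagrange.nodal Finset.univ (chebNode p) := by
  have hroots : (Chebyshev.T ℝ ((p + 1 : ℕ) : ℤ)).roots =
      Finset.univ.val.map (chebNode p) := by
    rw [Chebyshev.roots_T_real, ← Finset.image_val_of_injOn (chebNode_injective p).injOn]
    congr 1
    ext x
    simp only [Finset.mem_image, Finset.mem_range, Finset.mem_univ, true_and, chebNode]
    constructor
    · rintro ⟨k, hk, rfl⟩
      exact ⟨⟨k, hk⟩, by simp⟩
    · rintro ⟨k, rfl⟩
      exact ⟨k, k.2, by simp⟩
  have h := C_leadingCoeff_mul_prod_multiset_X_sub_C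
    (p := Chebyshev.T ℝ ((p + 1 : ℕ) : ℤ))
    (by rw [hroots, Chebyshev.natDegree_T, Int.natAbs_natCast]; simp)
  rw [hroots, Multiset.map_map] at h
  exact h.symm

open Polynomial in
lemma eval_chebyshev_T_chebNode (p : ℕ) (j : Fin (p + 1)) :
    (Chebyshev.T ℝ ((p + 1 : ℕ) : ℤ)).eval (chebNode p j) = 0 := by
  rw [chebyshev_T_eq_leadingCoeff_mul_nodal, eval_mul,
    Lagrange.eval_nodal_at_node (Finset.mem_univ j), mul_zero]

open Polynomial in
/-- Markov's inequality for the Chebyshev polynomial itself: `|T_n'| ≤ n²` on `[-1, 1]`. -/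
lemma abs_eval_derivative_chebyshev_T_le (n : ℕ) {t : ℝ} (ht : |t| ≤ 1) :
    |(derivative (Chebyshev.T ℝ (n : ℤ))).eval t| ≤ (n : ℝ) * n := by
  have h := Chebyshev.abs_iterate_derivative_T_real_le (n : ℤ) 1 ht
  simp only [Function.iterate_one] at h
  refine h.trans_eq ?_
  rw [Chebyshev.T_derivative_eq_U]
  simp

open Polynomial in
/-- At a zero `cos θ` of `T_n`, `|T_n'| = n / sin θ`. -/
lemma le_abs_eval_derivative_chebyshev_T_chebNode (p : ℕ) (j : Fin (p + 1)) :
    (p : ℝ) + 1 ≤ |(derivative (Chebyshev.T ℝ ((p + 1 : ℕ) : ℤ))).eval (chebNode p j)| := by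
  have hU : 1 ≤ |(Chebyshev.U ℝ (((p + 1 : ℕ) : ℤ) - 1)).eval (chebNode p j)| := by
    set θ : ℝ := (2 * (j : ℝ) + 1) * Real.pi / (2 * ((p : ℝ) + 1)) with hθ
    have h1 : (Chebyshev.U ℝ (((p + 1 : ℕ) : ℤ) - 1)).eval (chebNode p j) * Real.sin θ =
        Real.sin (((p : ℝ) + 1) * θ) := by
      simp [chebNode, hθ]
    have h2 : Real.cos (((p : ℝ) + 1) * θ) = 0 := by
      have := Chebyshev.T_real_cos θ ((p + 1 : ℕ) : ℤ)
      have h0 := eval_chebyshev_T_chebNode p j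
      rwa [chebNode, this, Int.cast_natCast, Nat.cast_add_one] at h0
    have h3 : |Real.sin (((p : ℝ) + 1) * θ)| = 1 := by
      have := Real.sin_sq_add_cos_sq (((p : ℝ) + 1) * θ)
      rw [h2] at this
      rw [← sq_abs] at this
      nlinarith [abs_nonneg (Real.sin (((p : ℝ) + 1) * θ))]
    rw [← h1, abs_mul] at h3
    calc (1 : ℝ) = _ := h3.symm
      _ ≤ _ := mul_le_of_le_one_right (abs_nonneg _) (Real.abs_sin_le_one θ)
  rw [Chebyshev.T_derivative_eq_U, eval_mul, abs_mul]
  have : |eval (chebNode p j) (((((p + 1 : ℕ) : ℤ) : ℝ[X])))| = (p : ℝ) + 1 := by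
    simp [abs_of_nonneg (by positivity : (0 : ℝ) ≤ p + 1)]
  rw [this]
  exact le_mul_of_one_le_right (by positivity) hU

open Polynomial in
/-- With `n = p + 1`, off the nodes `ℓ_j(t) = T_n(t) / ((t - x_j) T_n'(x_j))`. The mean value theorem
and the bound on `T_n'` give `|T_n(t)| ≤ n² |t - x_j|`, while `|T_n'(x_j)| ≥ n`. -/
lemma abs_eval_chebBasis_le (p : ℕ) (j : Fin (p + 1)) {t : ℝ} (ht : t ∈ Set.Icc (-1 : ℝ) 1) :
    |(chebBasis p j).eval t| ≤ (p : ℝ) + 1 := by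
  have hp : (0 : ℝ) < p + 1 := by positivity
  rcases eq_or_ne t (chebNode p j) with rfl | hne
  · rw [chebBasis, Lagrange.eval_basis_self (chebNode_injective p).injOn (Finset.mem_univ j)]
    simp
  set T := Chebyshev.T ℝ ((p + 1 : ℕ) : ℤ) with hT
  have hTd := le_abs_eval_derivative_chebyshev_T_chebNode p j
  rw [← hT] at hTd
  have hsub : t - chebNode p j ≠ 0 := sub_ne_zero.2 hne
  have key : (chebBasis p j).eval t * (derivative T).eval (chebNode p j) * (t - chebNode p j)
      = T.eval t := by
    have hd : (derivative T).eval (chebNode p j) = T.leadingCoeff *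
        (derivative (Lagrange.nodal Finset.univ (chebNode p))).eval (chebNode p j) := by
      conv_lhs => rw [hT, chebyshev_T_eq_leadingCoeff_mul_nodal]
      rw [derivative_C_mul, eval_mul, eval_C]
    have hne0 : (derivative (Lagrange.nodal Finset.univ (chebNode p))).eval (chebNode p j) ≠ 0 := by
      intro h0
      rw [hd, h0, mul_zero, abs_zero] at hTd
      linarith
    have ht' : T.eval t =
        T.leadingCoeff * (Lagrange.nodal Finset.univ (chebNode p)).eval t := by
      conv_lhs => rw [hT, chebyshev_T_eq_leadingCoeff_mul_nodal]
      rw [eval_mul, eval_C]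
    rw [chebBasis, ht', hd, Lagrange.eval_basis_not_at_node (Finset.mem_univ j) hne,
      Lagrange.nodalWeight_eq_eval_derivative_nodal (Finset.mem_univ j)]
    field_simp
  have hmv : |T.eval t| ≤ ((p : ℝ) + 1) * (p + 1) * |t - chebNode p j| := by
    have h := (convex_Icc (-1 : ℝ) 1).norm_image_sub_le_of_norm_hasDerivWithin_le
      (f := fun x => T.eval x) (f' := fun x => (derivative T).eval x)
      (C := ((p : ℝ) + 1) * (p + 1))
      (fun x _ => (T.hasDerivAt x).hasDerivWithinAt)
      (fun x hx => by
        have := abs_eval_derivative_chebyshev_T_le (p + 1) (t := x) (abs_le.2 hx)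
        simpa [hT] using this) (chebNode_mem_Icc p j) ht
    simpa only [Real.norm_eq_abs, hT, eval_chebyshev_T_chebNode, sub_zero] using h
  rw [← key, abs_mul, abs_mul] at hmv
  have h1 := le_of_mul_le_mul_right hmv (abs_pos.2 hsub)
  have h2 : |(chebBasis p j).eval t| * ((p : ℝ) + 1) ≤ ((p : ℝ) + 1) * (p + 1) :=
    (mul_le_mul_of_nonneg_left hTd (abs_nonneg _)).trans h1
  exact le_of_mul_le_mul_right h2 hp

/-- A polynomial bound for the Lebesgue constant of the Chebyshev points. It is far from the true
logarithmic growth, but any subexponential bound serves. -/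
lemma sum_abs_eval_chebBasis_le (p : ℕ) {t : ℝ} (ht : t ∈ Set.Icc (-1 : ℝ) 1) :
    ∑ j, |(chebBasis p j).eval t| ≤ ((p : ℝ) + 1) ^ 2 := by
  refine (Finset.sum_le_card_nsmul _ _ _ fun j _ => abs_eval_chebBasis_le p j ht).trans_eq ?_
  rw [Finset.card_univ, Fintype.card_fin, nsmul_eq_mul, sq, Nat.cast_add_one]

open Polynomial in
lemma sum_eval_chebNode_mul_chebBasis {p : ℕ} {P : ℝ[X]} (hP : P.natDegree ≤ p) (t : ℝ) :
    ∑ j, P.eval (chebNode p j) * (chebBasis p j).eval t = P.eval t := by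
  have h := Lagrange.eq_interpolate (s := Finset.univ) (v := chebNode p)
    (chebNode_injective p).injOn (f := P) (by
      refine (degree_le_natDegree).trans_lt ?_
      rw [Finset.card_univ, Fintype.card_fin]
      exact_mod_cast Nat.lt_succ_of_le hP)
  conv_rhs => rw [h]
  simp [Lagrange.interpolate_apply, eval_finsetSum, chebBasis]

/-! ### Transport to an interval -/

lemma toRef_mem_Icc {a b x : ℝ} (hx : x ∈ Set.Icc a b) : toRef a b x ∈ Set.Icc (-1 : ℝ) 1 := by
  rcases (hx.1.trans hx.2).eq_or_lt with rfl | hab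
  · simp [toRef]
  · have : 0 < b - a := sub_pos.2 hab
    rw [toRef, Set.mem_Icc, le_div_iff₀ this, div_le_iff₀ this]
    constructor <;> linarith [hx.1, hx.2]

lemma fromRef_mem_Icc {a b t : ℝ} (hab : a ≤ b) (ht : t ∈ Set.Icc (-1 : ℝ) 1) :
    fromRef a b t ∈ Set.Icc a b := by
  rw [fromRef, Set.mem_Icc]
  constructor <;> nlinarith [ht.1, ht.2]

/-- For `a < b` the two affine maps are inverse to each other; for `a = b` the map `fromRef` is
constant, and the claim holds because then `x = a`. -/
lemma fromRef_toRef {a b x : ℝ} (hx : x ∈ Set.Icc a b) : fromRef a b (toRef a b x) = x := by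
  rcases (hx.1.trans hx.2).eq_or_lt with rfl | hab
  · have : x = a := le_antisymm hx.2 hx.1
    simp [fromRef, this]
  · have : b - a ≠ 0 := (sub_pos.2 hab).ne'
    rw [fromRef, toRef]
    field_simp
    ring

open Polynomial in
lemma sum_fromRef_pow_mul_chebBasis {p e : ℕ} (he : e ≤ p) {a b x : ℝ} (hx : x ∈ Set.Icc a b) :
    ∑ j, fromRef a b (chebNode p j) ^ e * (chebBasis p j).eval (toRef a b x) = x ^ e := by
  have hdeg : ((C ((a + b) / 2) + C ((b - a) / 2) * X : ℝ[X]) ^ e).natDegree ≤ p := by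
    have h1 : (C ((a + b) / 2) + C ((b - a) / 2) * X : ℝ[X]).natDegree ≤ 1 := by compute_degree
    exact (natDegree_pow_le_of_le e h1).trans (by simpa using he)
  have h := sum_eval_chebNode_mul_chebBasis hdeg (toRef a b x)
  simp only [eval_pow, eval_add, eval_mul, eval_C, eval_X] at h
  calc _ = fromRef a b (toRef a b x) ^ e := h
    _ = x ^ e := by rw [fromRef_toRef hx]

/-! ### Tensor product interpolation -/

section Tensor

variable {ι : Type*} [Fintype ι] [DecidableEq ι]

lemma chebInterp_sub (p : ℕ) (a b : ι → ℝ) (f g : (ι → ℝ) → ℝ) (x : ι → ℝ) :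
    chebInterp p a b (fun z => f z - g z) x = chebInterp p a b f x - chebInterp p a b g x := by
  simp only [chebInterp, sub_mul, Finset.sum_sub_distrib]

/-- The sum over the tensor grid of a product of one-dimensional terms factorizes, so a monomial is
reproduced because each of its one-dimensional factors is. -/
lemma chebInterp_eval {p : ℕ} {Q : MvPolynomial ι ℝ} (hQ : ∀ i, Q.degreeOf i ≤ p) {a b x : ι → ℝ}
    (hx : ∀ i, x i ∈ Set.Icc (a i) (b i)) :
    chebInterp p a b (fun z => MvPolynomial.eval z Q) x = MvPolynomial.eval x Q := by
  simp only [chebInterp, MvPolynomial.eval_eq', Finset.sum_mul]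
  rw [Finset.sum_comm]
  refine Finset.sum_congr rfl fun d hd => ?_
  simp only [mul_assoc, ← Finset.mul_sum, ← Finset.prod_mul_distrib]
  congr 1
  rw [← Fintype.prod_sum fun i j => fromRef (a i) (b i) (chebNode p j) ^ d i *
    (chebBasis p j).eval (toRef (a i) (b i) (x i))]
  exact Finset.prod_congr rfl fun i _ => sum_fromRef_pow_mul_chebBasis
    ((MvPolynomial.monomial_le_degreeOf i hd).trans (hQ i)) (hx i)

/-- Stability: the Lebesgue constant of the tensor grid is at most the product of those of the
coordinate directions. -/
lemma abs_chebInterp_le (p : ℕ) {a b : ι → ℝ} {f : (ι → ℝ) → ℝ} {M : ℝ} {x : ι → ℝ}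
    (hf : ∀ z, (∀ i, z i ∈ Set.Icc (a i) (b i)) → |f z| ≤ M)
    (hx : ∀ i, x i ∈ Set.Icc (a i) (b i)) :
    |chebInterp p a b f x| ≤ M * (((p : ℝ) + 1) ^ 2) ^ Fintype.card ι := by
  have hM : 0 ≤ M := (abs_nonneg _).trans (hf x hx)
  calc |chebInterp p a b f x|
      ≤ ∑ k : ι → Fin (p + 1), M * ∏ i, |(chebBasis p (k i)).eval (toRef (a i) (b i) (x i))| := by
        refine (Finset.abs_sum_le_sum_abs _ _).trans (Finset.sum_le_sum fun k _ => ?_)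
        rw [abs_mul, Finset.abs_prod]
        exact mul_le_mul_of_nonneg_right
          (hf _ fun i => fromRef_mem_Icc ((hx i).1.trans (hx i).2) (chebNode_mem_Icc p _))
          (Finset.prod_nonneg fun i _ => abs_nonneg _)
    _ = M * ∏ i, ∑ j, |(chebBasis p j).eval (toRef (a i) (b i) (x i))| := by
        rw [← Finset.mul_sum, Fintype.prod_sum]
    _ ≤ M * ∏ _i : ι, ((p : ℝ) + 1) ^ 2 :=
        mul_le_mul_of_nonneg_left (Finset.prod_le_prod
          (fun i _ => Finset.sum_nonneg fun j _ => abs_nonneg _)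
          fun i _ => sum_abs_eval_chebBasis_le p (toRef_mem_Icc (hx i))) hM
    _ = _ := by simp

/-- Quasi-optimality of interpolation among polynomials of degree at most `p` in each variable. -/
lemma abs_sub_chebInterp_le {p : ℕ} {Q : MvPolynomial ι ℝ} (hQ : ∀ i, Q.degreeOf i ≤ p)
    {a b : ι → ℝ} {f : (ι → ℝ) → ℝ} {M : ℝ} {x : ι → ℝ}
    (hf : ∀ z, (∀ i, z i ∈ Set.Icc (a i) (b i)) → |f z - MvPolynomial.eval z Q| ≤ M)
    (hx : ∀ i, x i ∈ Set.Icc (a i) (b i)) :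
    |f x - chebInterp p a b f x| ≤ M * (1 + (((p : ℝ) + 1) ^ 2) ^ Fintype.card ι) := by
  have h1 := abs_chebInterp_le p hf hx
  rw [chebInterp_sub, chebInterp_eval hQ hx, abs_sub_comm] at h1
  calc |f x - chebInterp p a b f x|
      ≤ |f x - MvPolynomial.eval x Q| + |MvPolynomial.eval x Q - chebInterp p a b f x| :=
        abs_sub_le _ _ _
    _ ≤ M + M * (((p : ℝ) + 1) ^ 2) ^ Fintype.card ι := add_le_add (hf x hx) h1
    _ = _ := by ring

end Tensor

/-! ### Polynomial approximation of `s ↦ (s log s) / 2` away from zero -/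

open Polynomial in
/-- The polynomial is `t` times a Taylor polynomial of the logarithm at the right end point `K`. On
`[1, K]` the variable `1 - t / K` of the expansion stays in `[0, 1 - 1 / K]`, so the error decays
geometrically however large `K` is. -/
lemma exists_polynomial_mul_log_approx {K : ℝ} (hK : 1 < K) (N : ℕ) :
    ∃ P : ℝ[X], P.natDegree ≤ N ∧
      ∀ t ∈ Set.Icc 1 K, |t * Real.log t - P.eval t| ≤ K ^ 2 * (1 - 1 / K) ^ N := by
  have hK0 : 0 < K := by linarith
  have hlogK : Real.log K ≤ K := Real.log_le_self hK0.le
  rcases N with _ | m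
  · refine ⟨0, by simp, fun t ht => ?_⟩
    have h0 : 0 ≤ Real.log t := Real.log_nonneg ht.1
    have h1 : Real.log t ≤ K := (Real.log_le_log (by linarith [ht.1]) ht.2).trans hlogK
    rw [eval_zero, sub_zero, pow_zero, mul_one, abs_of_nonneg (mul_nonneg (by linarith [ht.1]) h0),
      sq]
    exact mul_le_mul ht.2 h1 h0 hK0.le
  · have hu : (1 - C (1 / K) * X : ℝ[X]).natDegree ≤ 1 := by compute_degree
    refine ⟨X * (C (Real.log K) -
      ∑ i ∈ Finset.range m, C (1 / ((i : ℝ) + 1)) * (1 - C (1 / K) * X) ^ (i + 1)), ?_, ?_⟩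
    · refine natDegree_mul_le.trans ?_
      rw [natDegree_X, add_comm]
      refine Nat.add_le_add_right ((natDegree_sub_le _ _).trans (max_le (by simp) ?_)) 1
      refine natDegree_sum_le_of_forall_le _ _ fun i hi => ?_
      refine (natDegree_C_mul_le _ _).trans ((natDegree_pow_le_of_le (i + 1) hu).trans ?_)
      have := Finset.mem_range.1 hi
      omega
    · intro t ht
      have ht0 : 0 < t := by linarith [ht.1]
      set u : ℝ := 1 - 1 / K * t with hu_def
      have htu : t = K * (1 - u) := by rw [hu_def]; field_simp; ring
      have hu1 : 0 < 1 - u := by rw [hu_def]; ring_nf; positivity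
      have hu0 : 0 ≤ u := by
        have : 1 / K * t ≤ 1 := by rw [one_div_mul_eq_div]; exact (div_le_one hK0).2 ht.2
        linarith
      have huρ : u ≤ 1 - 1 / K := by
        have : 1 / K * 1 ≤ 1 / K * t := mul_le_mul_of_nonneg_left ht.1 (by positivity)
        linarith
      have hlog : Real.log t = Real.log K + Real.log (1 - u) := by
        conv_lhs => rw [htu]
        exact Real.log_mul hK0.ne' hu1.ne'
      have h := Real.abs_log_sub_add_sum_range_le (x := u) (by rw [abs_of_nonneg hu0]; linarith) m
      rw [abs_of_nonneg hu0] at h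
      have heq : t * Real.log t - (X * (C (Real.log K) - ∑ i ∈ Finset.range m,
          C (1 / ((i : ℝ) + 1)) * (1 - C (1 / K) * X) ^ (i + 1))).eval t =
          t * ((∑ i ∈ Finset.range m, u ^ (i + 1) / (i + 1)) + Real.log (1 - u)) := by
        simp only [eval_mul, eval_X, eval_sub, eval_C, eval_finsetSum, eval_pow, eval_one,
          ← hu_def, hlog]
        simp only [one_div_mul_eq_div]
        ring
      rw [heq, abs_mul, abs_of_pos ht0]
      calc t * |(∑ i ∈ Finset.range m, u ^ (i + 1) / (i + 1)) + Real.log (1 - u)|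
          ≤ t * (u ^ (m + 1) / (1 - u)) := mul_le_mul_of_nonneg_left h ht0.le
        _ = K * u ^ (m + 1) := by
            conv_lhs => rw [htu]
            field_simp
        _ ≤ K ^ 2 * (1 - 1 / K) ^ (m + 1) :=
            mul_le_mul (by nlinarith) (pow_le_pow_left₀ hu0 huρ _) (by positivity) (by positivity)

open Polynomial in
/-- Scaling `s = d² t` turns `(s log s) / 2` into `s log d + d² (t log t) / 2`. The first summand is
linear, so it is reproduced as soon as `N ≥ 1`; for `N = 0` it is responsible for the factor
`1 + |log d|`. -/
lemma exists_polynomial_half_mul_log_approx {K d : ℝ} (hK : 1 < K) (hd : 0 < d) (N : ℕ) :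
    ∃ P : ℝ[X], P.natDegree ≤ N ∧ ∀ s ∈ Set.Icc (d ^ 2) (K * d ^ 2),
      |s * Real.log s / 2 - P.eval s| ≤
        K ^ 2 * d ^ 2 * (1 + |Real.log d|) * (1 - 1 / K) ^ N := by
  have hK0 : 0 < K := by linarith
  have hρ : 0 ≤ 1 - 1 / K := by
    have : 1 / K ≤ 1 := (div_le_one hK0).2 hK.le
    linarith
  obtain ⟨P, hPdeg, hP⟩ := exists_polynomial_mul_log_approx hK N
  obtain ⟨L, hLdeg, hL⟩ : ∃ L : ℝ[X], L.natDegree ≤ N ∧ ∀ s ∈ Set.Icc (d ^ 2) (K * d ^ 2),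
      |s * Real.log d - L.eval s| ≤ K ^ 2 * d ^ 2 * |Real.log d| * (1 - 1 / K) ^ N := by
    rcases N with _ | m
    · refine ⟨0, by simp, fun s hs => ?_⟩
      have hs0 : 0 ≤ s := (sq_nonneg d).trans hs.1
      rw [eval_zero, sub_zero, pow_zero, mul_one, abs_mul, abs_of_nonneg hs0]
      refine mul_le_mul_of_nonneg_right (hs.2.trans ?_) (abs_nonneg _)
      exact mul_le_mul_of_nonneg_right (by nlinarith) (sq_nonneg d)
    · refine ⟨X * C (Real.log d), natDegree_mul_le.trans (by simp), fun s _ => ?_⟩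
      simp only [eval_mul, eval_X, eval_C, sub_self, abs_zero]
      positivity
  refine ⟨L + C (d ^ 2 / 2) * P.comp (C (1 / d ^ 2) * X), ?_, fun s hs => ?_⟩
  · refine (natDegree_add_le _ _).trans (max_le hLdeg ((natDegree_C_mul_le _ _).trans ?_))
    refine natDegree_comp_le.trans (le_trans ?_ hPdeg)
    have : (C (1 / d ^ 2) * X : ℝ[X]).natDegree ≤ 1 := by compute_degree
    exact (Nat.mul_le_mul_left _ this).trans_eq (mul_one _)
  · have hd2 : 0 < d ^ 2 := by positivity
    have hs0 : 0 < s := hd2.trans_le hs.1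
    set t : ℝ := 1 / d ^ 2 * s with ht_def
    have hst : s = d ^ 2 * t := by rw [ht_def]; field_simp
    have ht : t ∈ Set.Icc 1 K := by
      rw [ht_def, one_div_mul_eq_div, Set.mem_Icc, le_div_iff₀ hd2, div_le_iff₀ hd2, one_mul]
      exact hs
    have hlog : Real.log s = 2 * Real.log d + Real.log t := by
      conv_lhs => rw [hst]
      rw [Real.log_mul hd2.ne' (by linarith [ht.1]), Real.log_pow]
      norm_num
    have heq : s * Real.log s / 2 - (L + C (d ^ 2 / 2) * P.comp (C (1 / d ^ 2) * X)).eval s =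
        (s * Real.log d - L.eval s) + d ^ 2 / 2 * (t * Real.log t - P.eval t) := by
      simp only [eval_add, eval_mul, eval_C, eval_comp, eval_X, ← ht_def, hlog]
      have : s * Real.log t = d ^ 2 * t * Real.log t := by rw [← hst]
      linear_combination this / 2
    rw [heq]
    have h1 := hL s hs
    have h2 : |d ^ 2 / 2 * (t * Real.log t - P.eval t)| ≤ d ^ 2 * (K ^ 2 * (1 - 1 / K) ^ N) := by
      rw [abs_mul, abs_of_pos (by positivity : 0 < d ^ 2 / 2)]
      exact mul_le_mul (by linarith) (hP t ht) (abs_nonneg _) hd2.le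
    calc _ ≤ _ := abs_add_le _ _
      _ ≤ _ := add_le_add h1 h2
      _ = _ := by ring

/-! ### The kernel as a function of the squared distance -/

/-- The squared Euclidean distance `‖x - y‖²` as a polynomial in the four coordinates. -/
noncomputable def sqDistPoly : MvPolynomial (Fin 2 ⊕ Fin 2) ℝ :=
  (MvPolynomial.X (Sum.inl 0) - MvPolynomial.X (Sum.inr 0)) ^ 2 +
    (MvPolynomial.X (Sum.inl 1) - MvPolynomial.X (Sum.inr 1)) ^ 2

lemma degreeOf_sqDistPoly_le (i : Fin 2 ⊕ Fin 2) : sqDistPoly.degreeOf i ≤ 2 := by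
  have h (k l : Fin 2 ⊕ Fin 2) :
      ((MvPolynomial.X k - MvPolynomial.X l : MvPolynomial (Fin 2 ⊕ Fin 2) ℝ) ^ 2).degreeOf i
        ≤ 2 := by
    refine (MvPolynomial.degreeOf_pow_le _ _ _).trans ?_
    have h1 : (MvPolynomial.X k - MvPolynomial.X l :
        MvPolynomial (Fin 2 ⊕ Fin 2) ℝ).degreeOf i ≤ 1 := by
      refine (MvPolynomial.degreeOf_sub_le _ _ _).trans (max_le ?_ ?_) <;>
      · rw [MvPolynomial.degreeOf_X]
        split_ifs <;> simp
    omega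
  exact (MvPolynomial.degreeOf_add_le _ _ _).trans (max_le (h _ _) (h _ _))

lemma eval_sqDistPoly (z : Fin 2 ⊕ Fin 2 → ℝ) :
    MvPolynomial.eval z sqDistPoly =
      ‖(WithLp.toLp 2 fun i => z (Sum.inl i) : EuclideanSpace ℝ (Fin 2)) -
        WithLp.toLp 2 fun i => z (Sum.inr i)‖ ^ 2 := by
  rw [EuclideanSpace.norm_sq_eq]
  simp [sqDistPoly]

lemma tpsKernel_eq (z : Fin 2 ⊕ Fin 2 → ℝ) :
    tpsKernel z = MvPolynomial.eval z sqDistPoly *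
      Real.log (MvPolynomial.eval z sqDistPoly) / 2 := by
  rw [tpsKernel, phi2, eval_sqDistPoly, Real.log_pow]
  push_cast
  ring

lemma MvPolynomial.degreeOf_aeval_le {σ : Type*} (S : MvPolynomial σ ℝ) (P : Polynomial ℝ)
    (i : σ) : (Polynomial.aeval S P).degreeOf i ≤ P.natDegree * S.degreeOf i := by
  rw [Polynomial.aeval_eq_sum_range]
  refine (MvPolynomial.degreeOf_sum_le _ _ _).trans (Finset.sup_le fun k hk => ?_)
  rw [MvPolynomial.smul_eq_C_mul]
  refine (MvPolynomial.degreeOf_C_mul_le _ _ _).trans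
    ((MvPolynomial.degreeOf_pow_le _ _ _).trans (Nat.mul_le_mul_right _ ?_))
  exact Nat.lt_succ_iff.1 (Finset.mem_range.1 hk)

lemma MvPolynomial.eval_aeval {σ : Type*} (S : MvPolynomial σ ℝ) (P : Polynomial ℝ) (z : σ → ℝ) :
    MvPolynomial.eval z (Polynomial.aeval S P) = P.eval (MvPolynomial.eval z S) := by
  simp [Polynomial.aeval_eq_sum_range, Polynomial.eval_eq_sum_range, MvPolynomial.smul_eval]

/-! ### Distances between points of two boxes -/

lemma isBounded_box (a b : Fin 2 → ℝ) : Bornology.IsBounded (box a b) := by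
  refine Metric.isBounded_iff.2 ⟨√(∑ i, (b i - a i) ^ 2), fun x hx y hy => ?_⟩
  rw [EuclideanSpace.dist_eq]
  refine Real.sqrt_le_sqrt (Finset.sum_le_sum fun i _ => ?_)
  exact pow_le_pow_left₀ dist_nonneg (Real.dist_le_of_mem_Icc (hx i) (hy i)) 2

lemma setDist_nonneg (S T : Set (EuclideanSpace ℝ (Fin 2))) : 0 ≤ setDist S T :=
  Real.sInf_nonneg (by rintro _ ⟨x, -, y, -, rfl⟩; exact dist_nonneg)

lemma setDist_le_dist {S T : Set (EuclideanSpace ℝ (Fin 2))} {x y : EuclideanSpace ℝ (Fin 2)}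
    (hx : x ∈ S) (hy : y ∈ T) : setDist S T ≤ dist x y :=
  csInf_le ⟨0, by rintro _ ⟨x, -, y, -, rfl⟩; exact dist_nonneg⟩ ⟨x, hx, y, hy, rfl⟩

lemma dist_le_diam_add_setDist_add_diam {S T : Set (EuclideanSpace ℝ (Fin 2))}
    (hS : Bornology.IsBounded S) (hT : Bornology.IsBounded T) {x y : EuclideanSpace ℝ (Fin 2)}
    (hx : x ∈ S) (hy : y ∈ T) :
    dist x y ≤ Metric.diam S + setDist S T + Metric.diam T := by
  have h : dist x y - Metric.diam S - Metric.diam T ≤ setDist S T := by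
    refine le_csInf ⟨_, x, hx, y, hy, rfl⟩ ?_
    rintro _ ⟨x', hx', y', hy', rfl⟩
    have h1 := Metric.dist_le_diam_of_mem hS hx hx'
    have h2 := Metric.dist_le_diam_of_mem hT hy' hy
    have h3 := dist_triangle4 x x' y' y
    linarith
  linarith

lemma eq_of_diam_box_nonpos {a b : Fin 2 → ℝ} (h : Metric.diam (box a b) ≤ 0)
    {x y : EuclideanSpace ℝ (Fin 2)} (hx : x ∈ box a b) (hy : y ∈ box a b) : x = y :=
  dist_le_zero.1 ((Metric.dist_le_diam_of_mem (isBounded_box a b) hx hy).trans h)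

/-! ### The interpolation error -/

/-- The algebraic growth of the squared Lebesgue constants costs only part of the exponential
rate. -/
lemma exists_one_add_pow_mul_pow_half_le_exp {ρ : ℝ} (h0 : 0 < ρ) (h1 : ρ < 1) :
    ∃ C b : ℝ, 0 < C ∧ 0 < b ∧ ∀ p : ℕ,
      (1 + (((p : ℝ) + 1) ^ 2) ^ 4) * ρ ^ (p / 2) ≤ C * Real.exp (-b * p) := by
  -- With `ρ = exp (-4 * b)` the factor `ρ ^ (p / 2)` is about `exp (-2 * b * p)`; half of this
  -- exponent is spent on the polynomial factor.
  obtain ⟨b, hb, hρ⟩ : ∃ b : ℝ, 0 < b ∧ ρ = Real.exp (-(4 * b)) := by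
    refine ⟨-Real.log ρ / 4, by linarith [Real.log_neg h0 h1], ?_⟩
    rw [show -(4 * (-Real.log ρ / 4)) = Real.log ρ by ring, Real.exp_log h0]
  set c : ℝ := b / 8 with hc
  have hc0 : 0 < c := by positivity
  set M : ℝ := 1 + 1 / c with hM
  have hM0 : 0 < M := by positivity
  refine ⟨2 * M ^ 8 * Real.exp (2 * b), b, by positivity, hb, fun p => ?_⟩
  have hp : (0 : ℝ) ≤ p := Nat.cast_nonneg p
  have hlin : (p : ℝ) + 1 ≤ M * Real.exp (c * p) := by
    have h2 := Real.add_one_le_exp (c * p)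
    have h3 : (p : ℝ) + 1 ≤ M * (c * p + 1) := by
      have : M * (c * p + 1) = c * p + p + 1 + 1 / c := by rw [hM]; field_simp; ring
      rw [this]
      have : 0 ≤ c * p := by positivity
      have : 0 < 1 / c := by positivity
      linarith
    exact h3.trans (mul_le_mul_of_nonneg_left h2 hM0.le)
  have hpoly : 1 + (((p : ℝ) + 1) ^ 2) ^ 4 ≤ 2 * (M ^ 8 * Real.exp (b * p)) := by
    rw [← pow_mul]
    have h2 : (1 : ℝ) ≤ ((p : ℝ) + 1) ^ (2 * 4) := one_le_pow₀ (by linarith)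
    have h3 : ((p : ℝ) + 1) ^ (2 * 4) ≤ M ^ 8 * Real.exp (b * p) := by
      refine (pow_le_pow_left₀ (by positivity) hlin _).trans_eq ?_
      rw [mul_pow, ← Real.exp_nat_mul, hc]
      congr 2
      push_cast
      ring
    linarith
  have hexp : ρ ^ (p / 2) ≤ Real.exp (-(2 * b * p) + 2 * b) := by
    rw [hρ, ← Real.exp_nat_mul, Real.exp_le_exp]
    have : (p : ℝ) ≤ 2 * ((p / 2 : ℕ) : ℝ) + 1 := by
      have : p ≤ 2 * (p / 2) + 1 := by omega
      exact_mod_cast this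
    nlinarith
  calc (1 + (((p : ℝ) + 1) ^ 2) ^ 4) * ρ ^ (p / 2)
      ≤ 2 * (M ^ 8 * Real.exp (b * p)) * Real.exp (-(2 * b * p) + 2 * b) :=
        mul_le_mul hpoly hexp (by positivity) (by positivity)
    _ = 2 * M ^ 8 * (Real.exp (b * p) * Real.exp (-(2 * b * p) + 2 * b)) := by ring
    _ = 2 * M ^ 8 * (Real.exp (2 * b) * Real.exp (-b * p)) := by
        rw [← Real.exp_add, ← Real.exp_add]
        congr 2
        ring
    _ = _ := by ring

/-- The error bound for the four-variable kernel on any box on which the distance of the two points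
lies in `[d, √K d]`. -/
lemma abs_tpsKernel_sub_chebInterp_le {K d : ℝ} (hK : 1 < K) (hd : 0 < d) (p : ℕ)
    {a b x : Fin 2 ⊕ Fin 2 → ℝ}
    (hbox : ∀ z : Fin 2 ⊕ Fin 2 → ℝ, (∀ i, z i ∈ Set.Icc (a i) (b i)) →
      MvPolynomial.eval z sqDistPoly ∈ Set.Icc (d ^ 2) (K * d ^ 2))
    (hx : ∀ i, x i ∈ Set.Icc (a i) (b i)) :
    |tpsKernel x - chebInterp p a b tpsKernel x| ≤
      K ^ 2 * d ^ 2 * (1 + |Real.log d|) *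
        ((1 + (((p : ℝ) + 1) ^ 2) ^ 4) * (1 - 1 / K) ^ (p / 2)) := by
  obtain ⟨P, hPdeg, hP⟩ := exists_polynomial_half_mul_log_approx hK hd (p / 2)
  have hdeg (i) : (Polynomial.aeval sqDistPoly P).degreeOf i ≤ p :=
    calc _ ≤ _ := MvPolynomial.degreeOf_aeval_le _ _ _
      _ ≤ p / 2 * 2 := Nat.mul_le_mul hPdeg (degreeOf_sqDistPoly_le i)
      _ ≤ p := Nat.div_mul_le_self p 2
  refine (abs_sub_chebInterp_le
    (M := K ^ 2 * d ^ 2 * (1 + |Real.log d|) * (1 - 1 / K) ^ (p / 2)) hdeg (fun z hz => ?_)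
    hx).trans_eq ?_
  · rw [tpsKernel_eq, MvPolynomial.eval_aeval]
    exact hP _ (hbox z hz)
  · simp only [Fintype.card_sum, Fintype.card_fin]
    ring

theorem mainTheorem3 (η : ℝ) (hη : 0 < η) :
    ∃ C b : ℝ, 0 < C ∧ 0 < b ∧
      ∀ (aσ bσ aτ bτ : Fin 2 → ℝ), (∀ i, aσ i ≤ bσ i) → (∀ i, aτ i ≤ bτ i) →
        max (Metric.diam (box aσ bσ)) (Metric.diam (box aτ bτ)) ≤
          η * setDist (box aσ bσ) (box aτ bτ) →
        ∀ p : ℕ, ∀ x ∈ box aσ bσ, ∀ y ∈ box aτ bτ,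
          |phi2 ‖x - y‖ - tpsInterp p aσ bσ aτ bτ x y| ≤
            C * setDist (box aσ bσ) (box aτ bτ) ^ 2 *
              (1 + |Real.log (setDist (box aσ bσ) (box aτ bτ))|) * Real.exp (-b * (p : ℝ)) := by
  -- Points of the two boxes have distance at most `(1 + 2 * η) * d`, `d` the distance of the boxes.
  set K : ℝ := (1 + 2 * η) ^ 2 with hK_def
  have hK : 1 < K := one_lt_pow₀ (by linarith) two_ne_zero
  have hK0 : 0 < K := by linarith
  have hρ0 : 0 < 1 - 1 / K := sub_pos.2 ((div_lt_one hK0).2 hK)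
  have hρ1 : 1 - 1 / K < 1 := sub_lt_self 1 (by positivity)
  obtain ⟨C, b, hC, hb, hCb⟩ := exists_one_add_pow_mul_pow_half_le_exp hρ0 hρ1
  refine ⟨K ^ 2 * C, b, by positivity, hb, ?_⟩
  intro aσ bσ aτ bτ _ _ hdiam p x hx y hy
  set d := setDist (box aσ bσ) (box aτ bτ) with hd_def
  have hz : ∀ i, (Sum.elim (fun i => x i) (fun i => y i) : Fin 2 ⊕ Fin 2 → ℝ) i ∈
      Set.Icc (Sum.elim aσ aτ i) (Sum.elim bσ bτ i) := by
    rintro (i | i)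
    exacts [hx i, hy i]
  have hfst {z : Fin 2 ⊕ Fin 2 → ℝ}
      (hz : ∀ i, z i ∈ Set.Icc (Sum.elim aσ aτ i) (Sum.elim bσ bτ i)) :
      (WithLp.toLp 2 fun i => z (Sum.inl i) : EuclideanSpace ℝ (Fin 2)) ∈ box aσ bσ :=
    fun i => hz (Sum.inl i)
  have hsnd {z : Fin 2 ⊕ Fin 2 → ℝ}
      (hz : ∀ i, z i ∈ Set.Icc (Sum.elim aσ aτ i) (Sum.elim bσ bτ i)) :
      (WithLp.toLp 2 fun i => z (Sum.inr i) : EuclideanSpace ℝ (Fin 2)) ∈ box aτ bτ :=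
    fun i => hz (Sum.inr i)
  have hdσ := (le_max_left _ _).trans hdiam
  have hdτ := (le_max_right _ _).trans hdiam
  change |tpsKernel (Sum.elim (fun i => x i) (fun i => y i)) -
    chebInterp p (Sum.elim aσ aτ) (Sum.elim bσ bτ) tpsKernel
      (Sum.elim (fun i => x i) (fun i => y i))| ≤ _
  rcases (setDist_nonneg (box aσ bσ) (box aτ bτ)).eq_or_lt with hd0 | hd
  · -- Both boxes are single points, and the interpolant agrees with the kernel there.
    rw [← hd_def] at hd0
    rw [← hd0, mul_zero] at hdσ hdτ
    refine (abs_sub_chebInterp_le (M := 0) (Q := MvPolynomial.C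
      (tpsKernel (Sum.elim (fun i => x i) (fun i => y i)))) (by simp) (fun z hz' => ?_) hz).trans ?_
    · have h1 := eq_of_diam_box_nonpos hdσ (hfst hz') hx
      have h2 := eq_of_diam_box_nonpos hdτ (hsnd hz') hy
      rw [MvPolynomial.eval_C]
      unfold tpsKernel
      rw [h1, h2]
      simp
    · simp [← hd0]
  · rw [← hd_def] at hd
    refine (abs_tpsKernel_sub_chebInterp_le hK hd p (fun z hz' => ?_) hz).trans ?_
    · have hlow := setDist_le_dist (hfst hz') (hsnd hz')
      have hupp := dist_le_diam_add_setDist_add_diam (isBounded_box _ _) (isBounded_box _ _)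
        (hfst hz') (hsnd hz')
      rw [dist_eq_norm, ← hd_def] at hlow hupp
      rw [eval_sqDistPoly, hK_def, ← mul_pow]
      exact ⟨pow_le_pow_left₀ hd.le hlow 2,
        pow_le_pow_left₀ (norm_nonneg _) (by linarith) 2⟩
    · refine (mul_le_mul_of_nonneg_left (hCb p) (by positivity)).trans_eq ?_
      ring
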